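/- \textbf{Setting.} Let $n\ge 1$ and let $(A,B,C)$, with $A\in\mathbb R^{n\times n}$, $B\in\mathbb R^{n\times 1}$, $C\in\mathbb R^{1\times n}$, be controllable and observable, with transfer function $$W(z)=C(zI-A)^{-1}B=\frac{b_nz^{n-1}+\dots+b_2z+b_1}{z^n+a_nz^{n-1}+\dots+a_2z+a_1},\qquad z^n+a_nz^{n-1}+\dots+a_1=\det(zI-A).$$ The $j$-moment of a single-input single-output system with transfer function $W$ at a point $z$ that is not an eigenvalue of its state matrix is $\eta_j(z)=\frac{(-1)^j}{j!}W^{(j)}(z)$. $\lambda(\cdot)$ denotes the set of complex eigenvalues, $\|\cdot\|_2$ the spectral norm, $\|\cdot\|_F$ the Frobenius norm, $\sigma_{\min}$ the smallest singular value. \emph{Interpolation data.} Let $z_1,\dots,z_r\in\mathbb C\setminus(\lambda(A)\cup\{0\})$ be distinct, with multiplicities $m_{z_i}\ge1$, and $\nu=\sum_i m_{z_i}$. Let $S\in\mathbb R^{\nu\times\nu}$ be non-derogatory (its minimal and characteristic polynomials coincide) with characteristic polynomial $\prod_i (z-z_i)^{m_{z_i}}$, let $L\in\mathbb R^{1\times\nu}$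 be such that $(S,L)$ is observable, and let $G\in\mathbb R^{\nu\times 1}$ satisfy $\lambda(S)\cap\lambda(S-GL)=\emptyset$. Let $S_J=\operatorname{diag}(J_{m_{z_1}}(z_1),\dots,J_{m_{z_r}}(z_r))$ be the Jordan form of $S$ (upper triangular Jordan blocks) and $L_J$ the row vector that has, in each block, first entry $1$ and all other entries $0$. \emph{Input-output realisation.} Let $\widetilde A\in\mathbb R^{2n\times 2n}$, $\widetilde B\in\mathbb R^{2n}$ be the matrices for which, in the state $\widetilde x(k)=\operatorname{col}(y(k-n),\dots,y(k-1),u(k-n),\dots,u(k-1))$, the difference equation $y(k)+a_ny(k-1)+\dots+a_1y(k-n)=b_nu(k-1)+\dots+b_1u(k-n)$ reads $\widetilde x(k+1)=\widetilde A\widetilde x(k)+\widetilde Bu(k)$, that is $$\widetilde A=\begin{bmatrix}M&N\\0&Q\end{bmatrix},\qquad \widetilde B=\operatorname{col}(0,\dots,0,1),$$ where $Q\in\mathbb R^{n\times n}$ has ones on the first superdiagonal and zeros elsewhere, $M$ is obtained from $Q$ by replacing its last row by $(-a_1,\dots,-a_n)$, and $N\in\mathbb R^{n\times n}$ has last row $(b_1,\dots,b_n)$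 and zeros elsewhere. \emph{Data.} Let $u,y,x,d$ be signals defined for times $k\ge -n$ with $x(k+1)=Ax(k)+Bu(k)+d(k)$ and $y(k)=Cx(k)$, where $d$ is process noise, and let $\widetilde x$ be formed from $y,u$ as above. The process noise acting on the aggregated state is $\widetilde d(k):=\widetilde x(k+1)-\widetilde A\widetilde x(k)-\widetilde Bu(k)$. Let $\Delta u,\Delta y$ be arbitrary measurement noise signals and $\Delta\widetilde x(k)=\operatorname{col}(\Delta y(k-n),\dots,\Delta y(k-1),\Delta u(k-n),\dots,\Delta u(k-1))$. For a signal $v$ write $V_-=[v(0)\ \cdots\ v(T-1)]$ and $V_+=[v(1)\ \cdots\ v(T)]$ (capital letter for the corresponding lower case one), and put $$\bar X_\pm=\widetilde X_\pm+\Delta\widetilde X_\pm,\qquad \bar U_-=U_-+\Delta U_-,\qquad R_-=\widetilde A\,\Delta\widetilde X_--\Delta\widetilde X_++\widetilde B\,\Delta U_--\widetilde D_-.$$ Let $\hat G\in\mathbb R^{T\times\nu}$ be any solution of $\bar X_+\hat G=\bar X_-\hat GS$, $\bar U_-\hat G=L$, and consider the reduced model $$\xi(k+1)=(S-GL)\xi(k)+Gu(k),\qquad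 \psi(k)=e_n\bar X_-\hat GS\,\xi(k),$$ where $e_n\in\mathbb R^{1\times 2n}$ has entry $1$ in position $n$ and zeros elsewhere. Let $\eta_j$ and $\hat\eta_j$ be the moments of $(A,B,C)$ and of the reduced model. \textbf{Theorem.} There is a unique invertible $\mathcal T\in\mathbb C^{\nu\times\nu}$ with $S=\mathcal T^{-1}S_J\mathcal T$ and $L=L_J\mathcal T$, and for every $i$ and every $0\le j<m_{z_i}$, $$|\eta_j(z_i)-\hat\eta_j(z_i)|\le\frac{\|S\|_2\,\|\mathcal T^{-1}\|_2\,\|\hat G\|_F}{\sigma_{\min}(I\otimes\widetilde A-S^\top\otimes I)}\,\|R_-\|_2 .$$ -/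

import Mathlib

open scoped Kronecker

noncomputable section

namespace MomentMatching

/-! ### Matrix norms, smallest singular value, spectrum -/

/-- The spectral norm `‖M‖₂` (operator norm for the Euclidean norms). -/
def matrixTwoNorm {𝕜 m n : Type*} [RCLike 𝕜] [Fintype m] [Fintype n] [DecidableEq n]
    (M : Matrix m n 𝕜) : ℝ :=
  ‖LinearMap.toContinuousLinearMap (Matrix.toEuclideanLin M)‖

/-- The Frobenius norm `‖M‖_F`. -/
def frobeniusNorm {𝕜 m n : Type*} [RCLike 𝕜] [Fintype m] [Fintype n] (M : Matrix m n 𝕜) : ℝ :=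
  Real.sqrt (∑ i, ∑ j, ‖M i j‖ ^ 2)

/-- The smallest singular value of a square matrix. Singular values are listed in decreasing order,
starting from index `0`, so that the last one has index `card n - 1`. -/
def sigmaMin {𝕜 n : Type*} [RCLike 𝕜] [Fintype n] [DecidableEq n] (M : Matrix n n 𝕜) : ℝ :=
  (Matrix.toEuclideanLin M).singularValues (Fintype.card n - 1)

/-- The set `λ(M)` of complex eigenvalues of a real matrix. -/
def eigenvalueSet {n : Type*} [Fintype n] [DecidableEq n] (M : Matrix n n ℝ) : Set ℂ :=
  spectrum ℂ (M.map Complex.ofReal)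

/-! ### Single-input single-output systems, transfer functions, moments -/

/-- Controllability of `(A, B)`: the matrix `[B, AB, …, A^(n-1) B]` has rank `n`. -/
def IsControllable {n : ℕ} (A : Matrix (Fin n) (Fin n) ℝ) (B : Matrix (Fin n) (Fin 1) ℝ) : Prop :=
  (Matrix.of fun i k : Fin n => (A ^ (k : ℕ) * B) i 0).rank = n

/-- Observability of `(A, C)`: the matrix with rows `C, CA, …, C A^(n-1)` has rank `n`. -/
def IsObservable {n : ℕ} (A : Matrix (Fin n) (Fin n) ℝ) (C : Matrix (Fin 1) (Fin n) ℝ) : Prop :=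
  (Matrix.of fun k j : Fin n => (C * A ^ (k : ℕ)) 0 j).rank = n

/-- The transfer function `C (zI - A)⁻¹ B`. -/
def transferFunction {n : ℕ} (A : Matrix (Fin n) (Fin n) ℝ) (B : Matrix (Fin n) (Fin 1) ℝ)
    (C : Matrix (Fin 1) (Fin n) ℝ) (z : ℂ) : ℂ :=
  (C.map Complex.ofReal * (z • (1 : Matrix (Fin n) (Fin n) ℂ) - A.map Complex.ofReal)⁻¹ *
    B.map Complex.ofReal) 0 0

/-- The `k`-moment `((-1)^k / k!) W^(k)(z)` of the system `(A, B, C)` at `z`. -/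
def moment {n : ℕ} (A : Matrix (Fin n) (Fin n) ℝ) (B : Matrix (Fin n) (Fin 1) ℝ)
    (C : Matrix (Fin 1) (Fin n) ℝ) (k : ℕ) (z : ℂ) : ℂ :=
  (-1) ^ k / (k.factorial : ℂ) * iteratedDeriv k (transferFunction A B C) z

/-! ### Coefficients of the transfer function -/

/-- `denCoeff A i` is the coefficient of `z^i` in the denominator `det(zI - A)`
of the transfer function. -/
def denCoeff {n : ℕ} (A : Matrix (Fin n) (Fin n) ℝ) (i : Fin n) : ℝ :=
  A.charpoly.coeff i

/-- The numerator `C adj(zI - A) B` of the transfer function. -/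
def numPoly {n : ℕ} (A : Matrix (Fin n) (Fin n) ℝ) (B : Matrix (Fin n) (Fin 1) ℝ)
    (C : Matrix (Fin 1) (Fin n) ℝ) : Polynomial ℝ :=
  (C.map Polynomial.C * A.charmatrix.adjugate * B.map Polynomial.C) 0 0

/-- `numCoeff A B C i` is the coefficient of `z^i` in the numerator of the transfer function. -/
def numCoeff {n : ℕ} (A : Matrix (Fin n) (Fin n) ℝ) (B : Matrix (Fin n) (Fin 1) ℝ)
    (C : Matrix (Fin 1) (Fin n) ℝ) (i : Fin n) : ℝ :=
  (numPoly A B C).coeff i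

/-- The numerator has degree smaller than `n`. -/
theorem numPoly_coeff_eq_zero {n : ℕ} (A : Matrix (Fin n) (Fin n) ℝ) (B : Matrix (Fin n) (Fin 1) ℝ)
    (C : Matrix (Fin 1) (Fin n) ℝ) {k : ℕ} (hk : n ≤ k) : (numPoly A B C).coeff k = 0 := by
  rcases Nat.eq_zero_or_pos n with rfl | hn
  · simp [numPoly, Matrix.mul_apply]
  have : Nonempty (Fin n) := ⟨⟨0, hn⟩⟩
  have h1 : A.charmatrix * A.charmatrix.adjugate = A.charpoly • 1 := Matrix.mul_adjugate _
  have h2 := congrArg matPolyEquiv h1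
  rw [map_mul, Matrix.matPolyEquiv_charmatrix, matPolyEquiv_smul_one] at h2
  have h3 : (matPolyEquiv A.charmatrix.adjugate).coeff k = 0 := by
    by_cases h0 : matPolyEquiv A.charmatrix.adjugate = 0
    · simp [h0]
    apply Polynomial.coeff_eq_zero_of_natDegree_lt
    have h4 := (Polynomial.monic_X_sub_C A).natDegree_mul' h0
    rw [h2, Polynomial.natDegree_X_sub_C] at h4
    have h5 : (A.charpoly.map (algebraMap ℝ (Matrix (Fin n) (Fin n) ℝ))).natDegree = n := by
      rw [(Matrix.charpoly_monic A).natDegree_map, Matrix.charpoly_natDegree_eq_dim,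
        Fintype.card_fin]
    omega
  have h6 : ∀ i j, (A.charmatrix.adjugate i j).coeff k = 0 := by
    intro i j
    rw [← matPolyEquiv_coeff_apply, h3, Matrix.zero_apply]
  simp only [numPoly, Matrix.mul_apply, Matrix.map_apply, Polynomial.finsetSum_coeff,
    Polynomial.coeff_mul_C, Polynomial.coeff_C_mul, h6]
  simp

/-- The coefficients are those of the transfer function:
`W(z) = (∑ bᵢ zⁱ) / (zⁿ + ∑ aᵢ zⁱ)`. -/
theorem transferFunction_eq_div {n : ℕ} (A : Matrix (Fin n) (Fin n) ℝ)
    (B : Matrix (Fin n) (Fin 1) ℝ) (C : Matrix (Fin 1) (Fin n) ℝ) (z : ℂ) :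
    transferFunction A B C z =
      (∑ i : Fin n, (numCoeff A B C i : ℂ) * z ^ (i : ℕ)) /
        (z ^ n + ∑ i : Fin n, (denCoeff A i : ℂ) * z ^ (i : ℕ)) := by
  let f : Polynomial ℝ →+* ℂ := Polynomial.eval₂RingHom Complex.ofRealHom z
  have hM : z • (1 : Matrix (Fin n) (Fin n) ℂ) - A.map Complex.ofReal = A.charmatrix.map f := by
    ext i j
    by_cases h : i = j
    · subst h
      simp [f, Matrix.charmatrix_apply_eq]
    · simp [f, h]
  have hdet : (A.charmatrix.map f).det =
      z ^ n + ∑ i : Fin n, (denCoeff A i : ℂ) * z ^ (i : ℕ) := by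
    have h1 : (A.charmatrix.map f).det = f A.charpoly := (RingHom.map_det f _).symm
    have h2 : A.charpoly.natDegree = n := by
      rw [Matrix.charpoly_natDegree_eq_dim, Fintype.card_fin]
    have h3 := Matrix.charpoly_monic A
    rw [h1]
    change A.charpoly.eval₂ Complex.ofRealHom z = _
    rw [Polynomial.eval₂_eq_sum_range, h2, Finset.sum_range_succ, Finset.sum_range, add_comm]
    rw [Polynomial.Monic, Polynomial.leadingCoeff, h2] at h3
    simp [h3, denCoeff]
  have hnum : (C.map Complex.ofReal * (A.charmatrix.map f).adjugate * B.map Complex.ofReal) 0 0 =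
      ∑ i : Fin n, (numCoeff A B C i : ℂ) * z ^ (i : ℕ) := by
    have h1 : (C.map Complex.ofReal * (A.charmatrix.map f).adjugate *
        B.map Complex.ofReal) 0 0 = f (numPoly A B C) := by
      have h2 : (A.charmatrix.map f).adjugate = A.charmatrix.adjugate.map f :=
        (RingHom.map_adjugate f _).symm
      rw [h2]
      simp only [numPoly, Matrix.mul_apply, Matrix.map_apply, map_sum, map_mul]
      simp [f]
    rw [h1]
    change (numPoly A B C).eval₂ Complex.ofRealHom z = _
    have h4 : (numPoly A B C).natDegree < n + 1 :=
      Nat.lt_succ_of_le (Polynomial.natDegree_le_iff_coeff_eq_zero.2 fun k hk =>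
        numPoly_coeff_eq_zero A B C hk.le)
    rw [Polynomial.eval₂_eq_sum_range' _ h4, Finset.sum_range_succ, Finset.sum_range,
      numPoly_coeff_eq_zero A B C le_rfl]
    simp [numCoeff]
  rw [transferFunction, hM, Matrix.inv_def, Matrix.mul_smul, Matrix.smul_mul, Matrix.smul_apply,
    hnum, hdet, Ring.inverse_eq_inv', smul_eq_mul, div_eq_mul_inv, mul_comm]

/-! ### The non-minimal input-output realisation -/

/-- The state matrix of the input-output realisation, in the coordinates
`(y(k-n), …, y(k-1), u(k-n), …, u(k-1))`; `a i`, `b i` (`i = 0, …, n-1`) are the coefficients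
of `z^i` in the denominator and in the numerator. -/
def ioStateMatrix {n : ℕ} (a b : Fin n → ℝ) : Matrix (Fin n ⊕ Fin n) (Fin n ⊕ Fin n) ℝ :=
  Matrix.fromBlocks
    (Matrix.of fun i j : Fin n =>
      if (i : ℕ) + 1 = n then -a j else if (i : ℕ) + 1 = (j : ℕ) then 1 else 0)
    (Matrix.of fun i j : Fin n => if (i : ℕ) + 1 = n then b j else 0)
    0
    (Matrix.of fun i j : Fin n => if (i : ℕ) + 1 = (j : ℕ) then 1 else 0)

/-- The input matrix of the input-output realisation: the last unit column vector. -/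
def ioInputMatrix (n : ℕ) : Matrix (Fin n ⊕ Fin n) (Fin 1) ℝ :=
  Matrix.of fun i _ => Sum.elim (fun _ => 0) (fun i : Fin n => if (i : ℕ) + 1 = n then 1 else 0) i

/-- The row vector `e_n` of length `2n`: its `n`-th entry is `1`, all others vanish. -/
def selectorRow (n : ℕ) : Matrix (Fin 1) (Fin n ⊕ Fin n) ℝ :=
  Matrix.of fun _ j => Sum.elim (fun j : Fin n => if (j : ℕ) + 1 = n then 1 else 0) (fun _ => 0) j

/-- The aggregated signal
`col(y(k-n), …, y(k-1), u(k-n), …, u(k-1))`. -/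
def aggregate (n : ℕ) (y u : ℤ → ℝ) (k : ℤ) : Fin n ⊕ Fin n → ℝ :=
  Sum.elim (fun i => y (k - n + (i : ℕ))) (fun i => u (k - n + (i : ℕ)))

/-- The process noise acting on the aggregated state, that is the signal `d̃` in
`x̃(k+1) = Ã x̃(k) + B̃ u(k) + d̃(k)`. -/
def aggregateProcessNoise {n : ℕ} (a b : Fin n → ℝ) (y u : ℤ → ℝ) (k : ℤ) : Fin n ⊕ Fin n → ℝ :=
  aggregate n y u (k + 1) -
    (Matrix.mulVec (ioStateMatrix a b) (aggregate n y u k) +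
      Matrix.mulVec (ioInputMatrix n) (fun _ => u k))

/-! ### Data matrices -/

/-- The data matrix `[s(0), s(1), …, s(T-1)]`. -/
def dataMinus {ι : Type*} (T : ℕ) (s : ℤ → ι → ℝ) : Matrix ι (Fin T) ℝ :=
  Matrix.of fun i t => s ((t : ℕ) : ℤ) i

/-- The data matrix `[s(1), s(2), …, s(T)]`. -/
def dataPlus {ι : Type*} (T : ℕ) (s : ℤ → ι → ℝ) : Matrix ι (Fin T) ℝ :=
  Matrix.of fun i t => s (((t : ℕ) : ℤ) + 1) i

/-- The encapsulated noise data matrix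
`Ã ΔX̃₋ - ΔX̃₊ + B̃ ΔU₋ - D̃₋`. -/
def noiseMatrix {n : ℕ} (T : ℕ) (a b : Fin n → ℝ) (y u Δy Δu : ℤ → ℝ) :
    Matrix (Fin n ⊕ Fin n) (Fin T) ℝ :=
  ioStateMatrix a b * dataMinus T (aggregate n Δy Δu) - dataPlus T (aggregate n Δy Δu)
    + ioInputMatrix n * dataMinus T (fun k (_ : Fin 1) => Δu k)
    - dataMinus T (aggregateProcessNoise a b y u)

/-! ### Jordan form of `(S, L)` -/

/-- The `k × k` (upper triangular) Jordan block with eigenvalue `μ`. -/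
def jordanBlock (k : ℕ) (μ : ℂ) : Matrix (Fin k) (Fin k) ℂ :=
  Matrix.of fun i j => if i = j then μ else if (i : ℕ) + 1 = (j : ℕ) then 1 else 0

/-- The Jordan matrix with one block of size `m i` for each eigenvalue `z i`. -/
def jordanMatrix {r : ℕ} (z : Fin r → ℂ) (m : Fin r → ℕ) :
    Matrix (Fin (∑ i, m i)) (Fin (∑ i, m i)) ℂ :=
  Matrix.reindex finSigmaFinEquiv finSigmaFinEquiv
    (Matrix.blockDiagonal' fun i => jordanBlock (m i) (z i))

/-- The selector row of the Jordan matrix: in every block the first entry is `1`,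
the others vanish. -/
def jordanRow {r : ℕ} (m : Fin r → ℕ) : Matrix (Fin 1) (Fin (∑ i, m i)) ℂ :=
  Matrix.of fun _ j => if ((finSigmaFinEquiv.symm j).2 : ℕ) = 0 then 1 else 0

/-- `P` is invertible with `S = P⁻¹ S_J P` and `L = L_J P`. -/
def IsJordanTransformation {r : ℕ} (z : Fin r → ℂ) (m : Fin r → ℕ)
    (S : Matrix (Fin (∑ i, m i)) (Fin (∑ i, m i)) ℝ) (L : Matrix (Fin 1) (Fin (∑ i, m i)) ℝ)
    (P : Matrix (Fin (∑ i, m i)) (Fin (∑ i, m i)) ℂ) : Prop :=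
  IsUnit P ∧ S.map Complex.ofReal = P⁻¹ * jordanMatrix z m * P ∧
    L.map Complex.ofReal = jordanRow m * P

end MomentMatching

end

open MomentMatching

/-!
Moments are entries of the solution of a Sylvester equation. If `A X + B L = X S` and `P` brings
`(S, L)` to the Jordan pair `(S_J, L_J)`, then `Y = X P⁻¹` solves `A Y + B L_J = Y S_J`, and the
columns of `Y` in the `i`-th Jordan block are `(-1)^j (z i I - A)^(-(j+1)) B`. These are the
derivatives of the resolvent, up to the factors `1 / j!`, so that the entries of `C X P⁻¹` are the
moments at the points `z i`, up to sign (`IsJordanTransformation.iteratedDeriv_eq`).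

This applies to both systems. The full-order system has the same transfer function as the
input-output realisation `(Ã, B̃, e_n Ã)` near each `z i` (`transferFunction_eventuallyEq`), whose
Sylvester equation has a solution `Π`; as `e_n B̃ = 0`, its moments are the entries of
`e_n Π S P⁻¹`. For the reduced model the Sylvester equation is solved by the identity matrix, and
its moments are the entries of `e_n X̄₋ Ĝ S P⁻¹`.

The noisy data satisfy `X̄₊ = Ã X̄₋ + B̃ Ū₋ - R₋` (`noisy_data_equation`), so the error
`E = Π - X̄₋ Ĝ` solves `Ã E - E S = -R₋ Ĝ`. The matrix of the Sylvester operator is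
`I ⊗ Ã - Sᵀ ⊗ I`, which is invertible as no `z i` is an eigenvalue of `Ã`; hence `‖E‖_F` is at most
`‖R₋ Ĝ‖_F / σ_min` (`frobeniusNorm_le_of_sylvester`), and the bound follows from the
submultiplicativity of the norms.

The transformation `P` is unique because it must satisfy `O(S_J, L_J) P = O(S, L)` for the
observability matrices, and it exists because this equation defines one: both observability matrices
are invertible, and `S` and `S_J` are annihilated by the same monic polynomial of degree `ν`
(`existsUnique_similarity`).
-/

open scoped Kronecker

namespace MomentMatching

/-! ### The Jordan pair and the transformation to it -/

theorem mul_jordanMatrix_apply_zero {ι : Type*} {r : ℕ} (z : Fin r → ℂ) (m : Fin r → ℕ)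
    (M : Matrix ι (Fin (∑ i, m i)) ℂ) (a : ι) (i : Fin r) (l : Fin (m i)) (hl : (l : ℕ) = 0) :
    (M * jordanMatrix z m) a (finSigmaFinEquiv ⟨i, l⟩) = z i * M a (finSigmaFinEquiv ⟨i, l⟩) := by
  rw [Matrix.mul_apply, ← finSigmaFinEquiv.sum_comp, Fintype.sum_sigma, Finset.sum_eq_single i,
    Finset.sum_eq_single l]
  · simp [jordanMatrix, jordanBlock, mul_comm]
  · intro b _ hb
    simp [jordanMatrix, jordanBlock, hb, hl]
  · simp
  · intro b _ hb
    refine Finset.sum_eq_zero fun k _ => ?_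
    simp [jordanMatrix, Matrix.blockDiagonal'_apply_ne _ _ _ hb]
  · simp

theorem mul_jordanMatrix_apply_succ {ι : Type*} {r : ℕ} (z : Fin r → ℂ) (m : Fin r → ℕ)
    (M : Matrix ι (Fin (∑ i, m i)) ℂ) (a : ι) (i : Fin r) (k l : Fin (m i))
    (hl : (k : ℕ) + 1 = l) :
    (M * jordanMatrix z m) a (finSigmaFinEquiv ⟨i, l⟩) =
      z i * M a (finSigmaFinEquiv ⟨i, l⟩) + M a (finSigmaFinEquiv ⟨i, k⟩) := by
  have hkl : l ≠ k := by rintro rfl; omega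
  rw [Matrix.mul_apply, ← finSigmaFinEquiv.sum_comp, Fintype.sum_sigma, Finset.sum_eq_single i,
    Finset.sum_eq_add l k hkl]
  · simp [jordanMatrix, jordanBlock, mul_comm, hl, hkl.symm]
  · intro b _ hb
    have : ¬ (b : ℕ) + 1 = l := fun h => hb.2 (Fin.ext (by omega))
    simp [jordanMatrix, jordanBlock, hb.1, this]
  · simp
  · simp
  · intro b _ hb
    refine Finset.sum_eq_zero fun k _ => ?_
    simp [jordanMatrix, Matrix.blockDiagonal'_apply_ne _ _ _ hb]
  · simp

theorem jordanRow_apply {r : ℕ} (m : Fin r → ℕ) (a : Fin 1) (i : Fin r) (l : Fin (m i)) :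
    jordanRow m a (finSigmaFinEquiv ⟨i, l⟩) = if (l : ℕ) = 0 then 1 else 0 := by
  rw [jordanRow, Matrix.of_apply, Equiv.symm_apply_apply]

/-- The first row of `q(J)`, for a Jordan block `J` with eigenvalue `z i`, lists the Taylor
coefficients of `q` at `z i`. -/
theorem jordanRow_mul_aeval_apply {r : ℕ} (z : Fin r → ℂ) (m : Fin r → ℕ)
    (q : Polynomial ℂ) (i : Fin r) (l : Fin (m i)) :
    (jordanRow m * Polynomial.aeval (jordanMatrix z m) q) 0 (finSigmaFinEquiv ⟨i, l⟩) =
      (Polynomial.taylor (z i) q).coeff l := by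
  induction q using Polynomial.induction_on' with
  | add p q hp hq => simp [Matrix.mul_add, hp, hq]
  | monomial k c =>
    rw [← Polynomial.C_mul_X_pow_eq_monomial]
    simp only [map_mul, Polynomial.aeval_C, map_pow, Polynomial.aeval_X, Polynomial.taylor_mul,
      Polynomial.taylor_C, Polynomial.taylor_X_pow, Polynomial.coeff_C_mul]
    rw [Algebra.algebraMap_eq_smul_one, Matrix.smul_mul, Matrix.one_mul, Matrix.mul_smul,
      Matrix.smul_apply, smul_eq_mul]
    congr 1
    induction k generalizing l with
    | zero =>
      rw [pow_zero, pow_zero, Matrix.mul_one, Polynomial.coeff_one, jordanRow_apply]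
    | succ k ih =>
      rw [pow_succ, ← Matrix.mul_assoc, pow_succ, mul_add, Polynomial.coeff_add,
        Polynomial.coeff_mul_C]
      rcases hl : (l : ℕ) with _ | s
      · rw [mul_jordanMatrix_apply_zero z m _ _ _ _ hl, ih, hl]
        simp [mul_comm]
      · have hs : s < m i := by have := l.2; omega
        rw [mul_jordanMatrix_apply_succ z m _ _ i ⟨s, hs⟩ l hl.symm, ih, ih,
          Polynomial.coeff_mul_X, hl]
        ring

/-- `L_J q(S_J) = 0` if and only if the polynomial `q` vanishes at each `z i` to the order `m i`. -/
theorem jordanRow_mul_aeval_eq_zero_iff {r : ℕ} (z : Fin r → ℂ) (hz : Function.Injective z)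
    (m : Fin r → ℕ) (q : Polynomial ℂ) :
    jordanRow m * Polynomial.aeval (jordanMatrix z m) q = 0 ↔
      ∏ i, (Polynomial.X - Polynomial.C (z i)) ^ m i ∣ q := by
  have key : jordanRow m * Polynomial.aeval (jordanMatrix z m) q = 0 ↔
      ∀ i, (Polynomial.X - Polynomial.C (z i)) ^ m i ∣ q := by
    simp_rw [Polynomial.X_sub_C_pow_dvd_iff, Polynomial.X_pow_dvd_iff, ← Polynomial.taylor_apply]
    constructor
    · intro h i d hd
      rw [← jordanRow_mul_aeval_apply z m q i ⟨d, hd⟩, h, Matrix.zero_apply]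
    · intro h
      ext a j
      obtain ⟨⟨i, l⟩, rfl⟩ := finSigmaFinEquiv.surjective j
      rw [Subsingleton.elim a 0, jordanRow_mul_aeval_apply, h i l l.2, Matrix.zero_apply]
  have hdvd (i : Fin r) : (Polynomial.X - Polynomial.C (z i)) ^ m i ∣
      ∏ i, (Polynomial.X - Polynomial.C (z i)) ^ m i :=
    Finset.dvd_prod_of_mem (fun i => (Polynomial.X - Polynomial.C (z i)) ^ m i) (Finset.mem_univ i)
  rw [key]
  refine ⟨fun h => Finset.prod_dvd_of_coprime ?_ fun i _ => h i, fun h i => (hdvd i).trans h⟩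
  intro i _ j _ hij
  have hco : IsCoprime (Polynomial.X - Polynomial.C (z i)) (Polynomial.X - Polynomial.C (z j)) :=
    Polynomial.pairwise_coprime_X_sub_C hz hij
  exact hco.pow

/-- The observability matrix of `(S, L)`: its rows are `L, LS, …, LS^(N-1)`. -/
def observabilityMatrix {R : Type*} [CommRing R] {N : ℕ} (S : Matrix (Fin N) (Fin N) R)
    (L : Matrix (Fin 1) (Fin N) R) : Matrix (Fin N) (Fin N) R :=
  Matrix.of fun k j => (L * S ^ (k : ℕ)) 0 j

theorem observabilityMatrix_mul_apply {R : Type*} [CommRing R] {N : ℕ}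
    (S : Matrix (Fin N) (Fin N) R)
    (L : Matrix (Fin 1) (Fin N) R) (M : Matrix (Fin N) (Fin N) R) (k j : Fin N) :
    (observabilityMatrix S L * M) k j = (L * S ^ (k : ℕ) * M) 0 j := by
  simp [observabilityMatrix, Matrix.mul_apply]

/-- A combination of the rows of the observability matrix is `L q(S)`, where the polynomial `q`
carries the coefficients of the combination. -/
theorem vecMul_observabilityMatrix {R : Type*} [CommRing R] {N : ℕ}
    (S : Matrix (Fin N) (Fin N) R) (L : Matrix (Fin 1) (Fin N) R) (c : Fin N → R) :
    Matrix.vecMul c (observabilityMatrix S L) =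
      (L * Polynomial.aeval S (∑ k : Fin N, Polynomial.monomial (k : ℕ) (c k))) 0 := by
  ext j
  simp only [map_sum, Polynomial.aeval_monomial, Algebra.algebraMap_eq_smul_one, Matrix.smul_mul,
    Matrix.one_mul, Matrix.mul_sum, Matrix.mul_smul, Matrix.sum_apply, Matrix.smul_apply,
    smul_eq_mul, observabilityMatrix, Matrix.vecMul, dotProduct, Matrix.of_apply]

/-- The Jordan pair is observable: its observability matrix is a confluent Vandermonde matrix. A
vanishing combination of the rows is a polynomial of degree less than `∑ i, m i` that is divisible
by `∏ i, (X - z i) ^ m i`. -/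
theorem isUnit_observabilityMatrix_jordan {r : ℕ} (z : Fin r → ℂ) (hz : Function.Injective z)
    (m : Fin r → ℕ) : IsUnit (observabilityMatrix (jordanMatrix z m) (jordanRow m)) := by
  rw [← Matrix.vecMul_injective_iff_isUnit]
  refine (injective_iff_map_eq_zero (Matrix.vecMulLinear
    (observabilityMatrix (jordanMatrix z m) (jordanRow m)))).2 fun c hc => ?_
  rw [Matrix.vecMulLinear_apply, vecMul_observabilityMatrix] at hc
  set q : Polynomial ℂ := ∑ k : Fin (∑ i, m i), Polynomial.monomial (k : ℕ) (c k) with hq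
  have hdvd := (jordanRow_mul_aeval_eq_zero_iff z hz m q).1 (by
    ext a j
    rw [Subsingleton.elim a 0, hc]; rfl)
  have hdeg : (∏ i, (Polynomial.X - Polynomial.C (z i)) ^ m i).degree =
      ((∑ i, m i : ℕ) : WithBot ℕ) := by
    rw [Polynomial.degree_prod]
    simp
  have hqdeg : q.degree < ((∑ i, m i : ℕ) : WithBot ℕ) := by
    refine (Polynomial.degree_sum_le _ _).trans_lt ?_
    rw [Finset.sup_lt_iff (WithBot.bot_lt_coe _)]
    exact fun k _ => (Polynomial.degree_monomial_le _ _).trans_lt (by exact_mod_cast k.2)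
  have hq0 : q = 0 := by
    by_contra h0
    exact absurd (Polynomial.degree_le_of_dvd hdvd h0) (by rw [hdeg]; exact not_le.2 hqdeg)
  ext k
  have := congrArg (fun p => Polynomial.coeff p (k : ℕ)) hq0
  simpa [hq, Polynomial.finsetSum_coeff, Polynomial.coeff_monomial, Fin.val_inj] using this

theorem aeval_jordanMatrix_eq_zero {r : ℕ} (z : Fin r → ℂ) (hz : Function.Injective z)
    (m : Fin r → ℕ) :
    Polynomial.aeval (jordanMatrix z m) (∏ i, (Polynomial.X - Polynomial.C (z i)) ^ m i) = 0 := by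
  set p := ∏ i, (Polynomial.X - Polynomial.C (z i)) ^ m i with hp
  refine (isUnit_observabilityMatrix_jordan z hz m).mul_left_cancel ?_
  rw [mul_zero]
  ext k j
  rw [observabilityMatrix_mul_apply, Matrix.mul_assoc]
  have := (jordanRow_mul_aeval_eq_zero_iff z hz m (Polynomial.X ^ (k : ℕ) * p)).2
    (Dvd.intro_left _ rfl)
  rw [map_mul, map_pow, Polynomial.aeval_X] at this
  rw [this]; rfl

/-- Any two observable pairs whose state matrices are annihilated by the same monic polynomial of
degree `N` are similar: `O(S₁, L₁)⁻¹ O(S₂, L₂)` is the transformation. -/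
theorem existsUnique_similarity {N : ℕ} (S₁ S₂ : Matrix (Fin N) (Fin N) ℂ)
    (L₁ L₂ : Matrix (Fin 1) (Fin N) ℂ) (p : Polynomial ℂ) (hp : p.Monic) (hpN : p.degree = N)
    (h₁ : Polynomial.aeval S₁ p = 0) (h₂ : Polynomial.aeval S₂ p = 0)
    (hO₁ : IsUnit (observabilityMatrix S₁ L₁)) (hO₂ : IsUnit (observabilityMatrix S₂ L₂)) :
    ∃! P : Matrix (Fin N) (Fin N) ℂ, IsUnit P ∧ S₂ = P⁻¹ * S₁ * P ∧ L₂ = L₁ * P := by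
  have hdet₁ := (Matrix.isUnit_iff_isUnit_det _).1 hO₁
  refine ⟨(observabilityMatrix S₁ L₁)⁻¹ * observabilityMatrix S₂ L₂, ?_, ?_⟩
  · set P := (observabilityMatrix S₁ L₁)⁻¹ * observabilityMatrix S₂ L₂ with hP
    have hPu : IsUnit P := ((Matrix.isUnit_nonsing_inv_iff).2 hO₁).mul hO₂
    have hOP : observabilityMatrix S₁ L₁ * P = observabilityMatrix S₂ L₂ := by
      rw [hP, Matrix.mul_nonsing_inv_cancel_left _ _ hdet₁]
    have hdeg (q : Polynomial ℂ) (hq : q.degree < N) :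
        L₁ * Polynomial.aeval S₁ q * P = L₂ * Polynomial.aeval S₂ q := by
      have hsum : q = ∑ k ∈ Finset.range N, Polynomial.monomial k (q.coeff k) := by
        ext k
        rw [Polynomial.finsetSum_coeff]
        simp only [Polynomial.coeff_monomial, Finset.sum_ite_eq', Finset.mem_range]
        split_ifs with hk
        · rfl
        · exact Polynomial.coeff_eq_zero_of_degree_lt
            (hq.trans_le (by exact_mod_cast not_lt.1 hk))
      have h := congrArg (Matrix.vecMul fun k : Fin N => q.coeff k) hOP
      rw [← Matrix.vecMul_vecMul, vecMul_observabilityMatrix, vecMul_observabilityMatrix,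
        Fin.sum_univ_eq_sum_range fun k => Polynomial.monomial k (q.coeff k),
        ← hsum] at h
      ext a j
      rw [Subsingleton.elim a 0]
      exact congrFun h j
    -- reduction modulo `p` extends the identity to polynomials of arbitrary degree
    have hall (q : Polynomial ℂ) :
        L₁ * Polynomial.aeval S₁ q * P = L₂ * Polynomial.aeval S₂ q := by
      rw [← Polynomial.aeval_modByMonic_eq_self_of_root h₁,
        ← Polynomial.aeval_modByMonic_eq_self_of_root h₂]
      exact hdeg _ (hpN ▸ Polynomial.degree_modByMonic_lt q hp)
    have hcomm : S₁ * P = P * S₂ := by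
      refine hO₁.mul_left_cancel ?_
      ext k j
      have h1 := hall (Polynomial.X ^ (k : ℕ) * Polynomial.X)
      have h2 := hall (Polynomial.X ^ (k : ℕ))
      simp only [map_mul, map_pow, Polynomial.aeval_X] at h1 h2
      rw [observabilityMatrix_mul_apply, observabilityMatrix_mul_apply, ← Matrix.mul_assoc _ P,
        h2, ← Matrix.mul_assoc _ S₁, Matrix.mul_assoc L₁, h1, Matrix.mul_assoc L₂]
    refine ⟨hPu, ?_, ?_⟩
    · rw [Matrix.mul_assoc, hcomm,
        Matrix.nonsing_inv_mul_cancel_left _ _ ((Matrix.isUnit_iff_isUnit_det _).1 hPu)]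
    · simpa using (hall 1).symm
  -- any such `P` satisfies `O(S₁, L₁) P = O(S₂, L₂)`
  · rintro P ⟨hPu, hS, hL⟩
    have hcomm : S₁ * P = P * S₂ := by
      rw [hS, Matrix.mul_assoc,
        Matrix.mul_nonsing_inv_cancel_left _ _ ((Matrix.isUnit_iff_isUnit_det _).1 hPu)]
    have hOP : observabilityMatrix S₁ L₁ * P = observabilityMatrix S₂ L₂ := by
      ext k j
      have hsc : SemiconjBy P (S₂ ^ (k : ℕ)) (S₁ ^ (k : ℕ)) :=
        SemiconjBy.pow_right (show P * S₂ = S₁ * P from hcomm.symm) _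
      rw [observabilityMatrix_mul_apply, Matrix.mul_assoc, ← hsc.eq, ← Matrix.mul_assoc, ← hL]
      rfl
    rw [← hOP, Matrix.nonsing_inv_mul_cancel_left _ _ hdet₁]

theorem isUnit_observabilityMatrix_of_isObservable {N : ℕ} (S : Matrix (Fin N) (Fin N) ℝ)
    (L : Matrix (Fin 1) (Fin N) ℝ) (h : IsObservable S L) :
    IsUnit (observabilityMatrix (S.map Complex.ofReal) (L.map Complex.ofReal)) := by
  have h1 : IsUnit (observabilityMatrix S L) := by
    rw [← Matrix.mulVec_surjective_iff_isUnit]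
    have h2 : (observabilityMatrix S L).mulVecLin.range = ⊤ :=
      Submodule.eq_top_of_finrank_eq (h.trans (by simp))
    exact LinearMap.range_eq_top.1 h2
  have h2 : observabilityMatrix (S.map Complex.ofReal) (L.map Complex.ofReal) =
      Complex.ofRealHom.mapMatrix (observabilityMatrix S L) := by
    ext k j
    have h3 : (L * S ^ (k : ℕ)).map Complex.ofRealHom =
        L.map Complex.ofRealHom * S.map Complex.ofRealHom ^ (k : ℕ) := by
      rw [Matrix.map_mul, Matrix.map_pow]
    exact (congrFun (congrFun h3 0) j).symm
  rw [h2]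
  exact h1.map _

theorem existsUnique_isJordanTransformation {r : ℕ} (z : Fin r → ℂ) (hz : Function.Injective z)
    (m : Fin r → ℕ) (S : Matrix (Fin (∑ i, m i)) (Fin (∑ i, m i)) ℝ)
    (L : Matrix (Fin 1) (Fin (∑ i, m i)) ℝ)
    (hSchar : S.charpoly.map (algebraMap ℝ ℂ) = ∏ i, (Polynomial.X - Polynomial.C (z i)) ^ m i)
    (hSL : IsObservable S L) :
    ∃! P : Matrix (Fin (∑ i, m i)) (Fin (∑ i, m i)) ℂ, IsJordanTransformation z m S L P := by
  refine existsUnique_similarity _ _ _ _ (∏ i, (Polynomial.X - Polynomial.C (z i)) ^ m i)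
    (hSchar ▸ S.charpoly_monic.map _) ?_ (aeval_jordanMatrix_eq_zero z hz m) ?_
    (isUnit_observabilityMatrix_jordan z hz m) (isUnit_observabilityMatrix_of_isObservable S L hSL)
  · rw [Polynomial.degree_prod]
    simp
  · rw [← hSchar, ← Matrix.charpoly_map]
    exact Matrix.aeval_self_charpoly _

/-! ### Norms and the Sylvester operator -/

section Norms
variable {𝕜 l m n : Type*} [RCLike 𝕜] [Fintype l] [Fintype m] [Fintype n]

theorem frobeniusNorm_nonneg (M : Matrix m n 𝕜) : 0 ≤ frobeniusNorm M := Real.sqrt_nonneg _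

theorem frobeniusNorm_sq (M : Matrix m n 𝕜) : frobeniusNorm M ^ 2 = ∑ i, ∑ j, ‖M i j‖ ^ 2 :=
  Real.sq_sqrt (by positivity)

theorem matrixTwoNorm_nonneg [DecidableEq n] (M : Matrix m n 𝕜) : 0 ≤ matrixTwoNorm M :=
  norm_nonneg _

theorem norm_apply_le_frobeniusNorm (M : Matrix m n 𝕜) (i : m) (j : n) :
    ‖M i j‖ ≤ frobeniusNorm M := by
  refine Real.le_sqrt_of_sq_le ?_
  refine le_trans ?_ (Finset.single_le_sum (fun i _ => by positivity) (Finset.mem_univ i))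
  exact Finset.single_le_sum (f := fun j => ‖M i j‖ ^ 2) (fun j _ => by positivity)
    (Finset.mem_univ j)

theorem frobeniusNorm_neg (M : Matrix m n 𝕜) : frobeniusNorm (-M) = frobeniusNorm M := by
  simp [frobeniusNorm]

theorem frobeniusNorm_conjTranspose (M : Matrix m n 𝕜) :
    frobeniusNorm M.conjTranspose = frobeniusNorm M := by
  rw [frobeniusNorm, Finset.sum_comm]
  simp [frobeniusNorm]

theorem frobeniusNorm_map_ofReal (M : Matrix m n ℝ) :
    frobeniusNorm (M.map Complex.ofReal) = frobeniusNorm M := by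
  simp [frobeniusNorm]

theorem matrixTwoNorm_conjTranspose [DecidableEq m] [DecidableEq n] (M : Matrix m n 𝕜) :
    matrixTwoNorm M.conjTranspose = matrixTwoNorm M :=
  Matrix.l2_opNorm_conjTranspose M

theorem frobeniusNorm_mul_le_matrixTwoNorm_mul [DecidableEq m] (M : Matrix l m 𝕜)
    (N : Matrix m n 𝕜) :
    frobeniusNorm (M * N) ≤ matrixTwoNorm M * frobeniusNorm N := by
  refine Real.sqrt_le_iff.2 ⟨mul_nonneg (matrixTwoNorm_nonneg M) (frobeniusNorm_nonneg N), ?_⟩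
  rw [mul_pow, frobeniusNorm_sq, Finset.sum_comm, Finset.sum_comm (f := fun i j => ‖N i j‖ ^ 2),
    Finset.mul_sum]
  refine Finset.sum_le_sum fun j _ => ?_
  have h := (LinearMap.toContinuousLinearMap (Matrix.toEuclideanLin M)).le_opNorm
    (WithLp.toLp 2 fun k => N k j)
  have h2 := pow_le_pow_left₀ (norm_nonneg _) h 2
  rw [mul_pow, EuclideanSpace.norm_sq_eq, EuclideanSpace.norm_sq_eq] at h2
  exact h2

theorem frobeniusNorm_mul_le_mul_matrixTwoNorm [DecidableEq m] [DecidableEq n] (M : Matrix l m 𝕜)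
    (N : Matrix m n 𝕜) :
    frobeniusNorm (M * N) ≤ frobeniusNorm M * matrixTwoNorm N := by
  rw [← frobeniusNorm_conjTranspose, Matrix.conjTranspose_mul, mul_comm (frobeniusNorm M),
    ← frobeniusNorm_conjTranspose M, ← matrixTwoNorm_conjTranspose N]
  exact frobeniusNorm_mul_le_matrixTwoNorm_mul _ _

theorem norm_toLp_vec (M : Matrix m n 𝕜) : ‖WithLp.toLp 2 M.vec‖ = frobeniusNorm M := by
  rw [EuclideanSpace.norm_eq, frobeniusNorm, Fintype.sum_prod_type, Finset.sum_comm]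
  rfl

/-- The last singular value bounds a linear map from below: expand `‖f v‖² = ⟪v, f* f v⟫` in an
eigenbasis of `f* f`. -/
theorem singularValues_mul_norm_le {E F : Type*} [NormedAddCommGroup E] [InnerProductSpace 𝕜 E]
    [FiniteDimensional 𝕜 E] [NormedAddCommGroup F] [InnerProductSpace 𝕜 F]
    [FiniteDimensional 𝕜 F] (f : E →ₗ[𝕜] F) (v : E) :
    f.singularValues (Module.finrank 𝕜 E - 1) * ‖v‖ ≤ ‖f v‖ := by
  set N := Module.finrank 𝕜 E with hN
  have hT := f.isSymmetric_adjoint_comp_self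
  let b := hT.eigenvectorBasis hN.symm
  have h1 : ((‖f v‖ ^ 2 : ℝ) : 𝕜) =
      ((∑ i, hT.eigenvalues hN.symm i * ‖b.repr v i‖ ^ 2 : ℝ) : 𝕜) := by
    have h2 : ((‖f v‖ ^ 2 : ℝ) : 𝕜) = inner 𝕜 v ((f.adjoint ∘ₗ f) v) := by
      rw [LinearMap.comp_apply, LinearMap.adjoint_inner_right, inner_self_eq_norm_sq_to_K]
      push_cast; rfl
    rw [h2, ← b.repr.inner_map_map, PiLp.inner_apply]
    push_cast
    refine Finset.sum_congr rfl fun i _ => ?_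
    have h4 := hT.eigenvectorBasis_apply_self_apply hN.symm v i
    rw [LinearMap.comp_apply] at h4
    rw [Function.comp_apply, h4, RCLike.inner_apply, mul_assoc, RCLike.mul_conj]
  have h3 : ‖f v‖ ^ 2 = ∑ i, hT.eigenvalues hN.symm i * ‖b.repr v i‖ ^ 2 := by
    exact_mod_cast h1
  refine le_of_sq_le_sq ?_ (norm_nonneg _)
  rw [h3, mul_pow, ← b.repr.norm_map v, EuclideanSpace.norm_sq_eq, Finset.mul_sum]
  refine Finset.sum_le_sum fun i _ => mul_le_mul_of_nonneg_right ?_ (by positivity)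
  rw [← f.sq_singularValues_fin hN.symm i]
  exact pow_le_pow_left₀ (f.singularValues_nonneg _)
    (f.singularValues_antitone (by have := i.2; omega)) 2

theorem sigmaMin_mul_norm_le [DecidableEq n] (K : Matrix n n 𝕜) (v : n → 𝕜) :
    sigmaMin K * ‖WithLp.toLp 2 v‖ ≤ ‖WithLp.toLp 2 (K.mulVec v)‖ := by
  have h := singularValues_mul_norm_le (Matrix.toEuclideanLin K) (WithLp.toLp 2 v)
  rw [finrank_euclideanSpace] at h
  exact h

theorem sigmaMin_pos [DecidableEq n] [Nonempty n] (K : Matrix n n 𝕜)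
    (hK : Function.Injective K.mulVec) : 0 < sigmaMin K := by
  refine (Matrix.toEuclideanLin K).injective_iff_forall_lt_finrank_singularValues_pos.1 ?_ _ ?_
  · intro v w h
    exact (WithLp.ofLp_injective 2) (hK ((WithLp.toLp_injective 2) h))
  · rw [finrank_euclideanSpace]
    have := Fintype.card_pos (α := n)
    omega
end Norms

section Sylvester
variable {ι κ : Type*} [Fintype ι] [Fintype κ] [DecidableEq ι] [DecidableEq κ]

theorem sylvester_mulVec_vec (A : Matrix ι ι ℝ) (S : Matrix κ κ ℝ) (X : Matrix ι κ ℝ) :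
    ((1 : Matrix κ κ ℝ) ⊗ₖ A - S.transpose ⊗ₖ (1 : Matrix ι ι ℝ)).mulVec X.vec =
      (A * X - X * S).vec := by
  rw [Matrix.sub_mulVec, Matrix.kronecker_mulVec_vec, Matrix.kronecker_mulVec_vec, Matrix.vec_sub]
  simp

/-- The Kronecker matrix of a Sylvester operator without kernel is injective. -/
theorem sylvester_injective (A : Matrix ι ι ℝ) (S : Matrix κ κ ℝ)
    (h : ∀ X : Matrix ι κ ℝ, A * X = X * S → X = 0) :
    Function.Injective
      ((1 : Matrix κ κ ℝ) ⊗ₖ A - S.transpose ⊗ₖ (1 : Matrix ι ι ℝ)).mulVec := by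
  intro v w hvw
  obtain ⟨X, rfl⟩ := Matrix.vec_bijective.surjective v
  obtain ⟨Y, rfl⟩ := Matrix.vec_bijective.surjective w
  rw [sylvester_mulVec_vec, sylvester_mulVec_vec] at hvw
  have h1 := Matrix.vec_bijective.injective hvw
  have h2 : X - Y = 0 := h _ (by
    rw [Matrix.mul_sub, Matrix.sub_mul]
    rw [sub_eq_sub_iff_sub_eq_sub] at h1
    exact h1)
  rw [sub_eq_zero.1 h2]

/-- A Sylvester operator without kernel is onto, by finite-dimensionality. -/
theorem exists_sylvester_solution (A : Matrix ι ι ℝ) (S : Matrix κ κ ℝ)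
    (h : ∀ X : Matrix ι κ ℝ, A * X = X * S → X = 0) (D : Matrix ι κ ℝ) :
    ∃ X : Matrix ι κ ℝ, A * X + D = X * S := by
  have hs := Matrix.mulVec_surjective_iff_isUnit.2
    (Matrix.mulVec_injective_iff_isUnit.1 (sylvester_injective A S h))
  obtain ⟨v, hv⟩ := hs (-D).vec
  obtain ⟨X, rfl⟩ := Matrix.vec_bijective.surjective v
  rw [sylvester_mulVec_vec] at hv
  refine ⟨X, ?_⟩
  have := Matrix.vec_bijective.injective hv
  rw [sub_eq_iff_eq_add] at this
  rw [this]; abel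

/-- The smallest singular value of the Kronecker matrix controls the inverse of the Sylvester
operator in the Frobenius norm, because vectorisation is isometric. -/
theorem frobeniusNorm_le_of_sylvester [Nonempty ι] [Nonempty κ] (A : Matrix ι ι ℝ)
    (S : Matrix κ κ ℝ) (h : ∀ X : Matrix ι κ ℝ, A * X = X * S → X = 0) (X : Matrix ι κ ℝ) :
    frobeniusNorm X ≤ frobeniusNorm (A * X - X * S) /
      sigmaMin ((1 : Matrix κ κ ℝ) ⊗ₖ A - S.transpose ⊗ₖ (1 : Matrix ι ι ℝ)) := by
  rw [le_div_iff₀ (sigmaMin_pos _ (sylvester_injective A S h)), mul_comm, ← norm_toLp_vec,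
    ← norm_toLp_vec, ← sylvester_mulVec_vec]
  exact sigmaMin_mul_norm_le _ _
end Sylvester

/-! ### Derivatives of the resolvent and Sylvester equations in Jordan coordinates -/

section Resolvent
open scoped Matrix.Norms.L2Operator
variable {ι : Type*} [Fintype ι] [DecidableEq ι]

theorem isUnit_smul_one_sub_iff (A : Matrix ι ι ℂ) (z : ℂ) :
    IsUnit (z • (1 : Matrix ι ι ℂ) - A) ↔ z ∉ spectrum ℂ A := by
  rw [spectrum.notMem_iff, Algebra.algebraMap_eq_smul_one]

theorem eventually_isUnit_smul_one_sub (A : Matrix ι ι ℂ) {z : ℂ}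
    (hz : IsUnit (z • (1 : Matrix ι ι ℂ) - A)) :
    ∀ᶠ w in nhds z, IsUnit (w • (1 : Matrix ι ι ℂ) - A) := by
  have hc : Continuous fun w : ℂ => w • (1 : Matrix ι ι ℂ) - A := by fun_prop
  exact hc.continuousAt.eventually (Units.isOpen.eventually_mem hz)

theorem hasDerivAt_resolvent_pow (A : Matrix ι ι ℂ) (j : ℕ) (z : ℂ)
    (hz : IsUnit (z • (1 : Matrix ι ι ℂ) - A)) :
    HasDerivAt (fun w : ℂ => ((w • (1 : Matrix ι ι ℂ) - A)⁻¹) ^ (j + 1))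
      (-((j + 1 : ℂ) • ((z • (1 : Matrix ι ι ℂ) - A)⁻¹) ^ (j + 2))) z := by
  have hR : (fun w : ℂ => (w • (1 : Matrix ι ι ℂ) - A)⁻¹) = resolvent A := by
    funext w
    rw [resolvent, Algebra.algebraMap_eq_smul_one, Matrix.nonsing_inv_eq_ringInverse]
  have h0 : HasDerivAt (fun w : ℂ => (w • (1 : Matrix ι ι ℂ) - A)⁻¹)
      (-((z • (1 : Matrix ι ι ℂ) - A)⁻¹) ^ 2) z := by
    have := spectrum.hasDerivAt_resolvent_const_left (𝕜 := ℂ) (a := A) (k := z)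
      (by rwa [spectrum.mem_resolventSet_iff, Algebra.algebraMap_eq_smul_one])
    rw [← hR] at this
    exact this
  induction j with
  | zero => simpa using h0
  | succ j ih =>
    have h := ih.mul h0
    refine (h.congr_deriv ?_)
    simp only [neg_mul, smul_mul_assoc, mul_neg, ← pow_succ, ← pow_add]
    push_cast
    module

/-- `W^(j)(z) = (-1)^j j! C (zI - A)^(-(j+1)) B` for `W(z) = C (zI - A)⁻¹ B`. -/
theorem iteratedDeriv_resolvent (A : Matrix ι ι ℂ) (B : Matrix ι (Fin 1) ℂ)
    (C : Matrix (Fin 1) ι ℂ) (j : ℕ) (z : ℂ) (hz : IsUnit (z • (1 : Matrix ι ι ℂ) - A)) :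
    iteratedDeriv j (fun w : ℂ => (C * (w • (1 : Matrix ι ι ℂ) - A)⁻¹ * B) 0 0) z =
      (-1) ^ j * j.factorial * (C * ((z • (1 : Matrix ι ι ℂ) - A)⁻¹) ^ (j + 1) * B) 0 0 := by
  induction j generalizing z with
  | zero => simp
  | succ j ih =>
    rw [iteratedDeriv_succ]
    have hev := (eventually_isUnit_smul_one_sub A hz).mono fun w hw => ih w hw
    rw [Filter.EventuallyEq.deriv_eq hev]
    -- entries of `C * X * B` depend linearly, hence continuously, on `X`
    let φ : Matrix ι ι ℂ →ₗ[ℂ] ℂ :=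
      { toFun := fun X => (C * X * B) 0 0
        map_add' := by intro X Y; simp [Matrix.mul_add, Matrix.add_mul]
        map_smul' := by intro c X; simp }
    have hφ : HasDerivAt (fun w : ℂ => φ (((w • (1 : Matrix ι ι ℂ) - A)⁻¹) ^ (j + 1)))
        (φ (-((j + 1 : ℂ) • ((z • (1 : Matrix ι ι ℂ) - A)⁻¹) ^ (j + 2)))) z :=
      (LinearMap.toContinuousLinearMap φ).hasFDerivAt.comp_hasDerivAt z
        (hasDerivAt_resolvent_pow A j z hz)
    refine (hφ.const_mul ((-1) ^ j * (j.factorial : ℂ))).deriv.trans ?_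
    rw [map_neg, map_smul]
    have hφa (X : Matrix ι ι ℂ) : φ X = (C * X * B) 0 0 := rfl
    rw [hφa, Nat.factorial_succ]
    push_cast
    simp only [smul_eq_mul]
    ring
end Resolvent

section JordanSylvester
variable {ι : Type*} [Fintype ι] [DecidableEq ι]

/-- In Jordan coordinates the Sylvester equation determines its solution column by column: in the
`i`-th block, `(z i I - A) y₀ = B` and `(z i I - A) y_(j+1) = -y_j`, so that
`y_j = (-1)^j (z i I - A)^(-(j+1)) B`. -/
theorem jordan_sylvester_column {r : ℕ} (z : Fin r → ℂ) (m : Fin r → ℕ) (A : Matrix ι ι ℂ)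
    (B : Matrix ι (Fin 1) ℂ) (Y : Matrix ι (Fin (∑ i, m i)) ℂ)
    (hY : A * Y + B * jordanRow m = Y * jordanMatrix z m) (i : Fin r)
    (hi : IsUnit (z i • (1 : Matrix ι ι ℂ) - A)) (j : ℕ) (hj : j < m i) :
    Y.submatrix id (fun _ : Fin 1 => finSigmaFinEquiv ⟨i, ⟨j, hj⟩⟩) =
      (-1 : ℂ) ^ j • (((z i • (1 : Matrix ι ι ℂ) - A)⁻¹) ^ (j + 1) * B) := by
  have hdet := (Matrix.isUnit_iff_isUnit_det _).1 hi
  have hAY (a : ι) (k : Fin (m i)) : (A * Y.submatrix id (fun _ : Fin 1 =>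
      finSigmaFinEquiv ⟨i, k⟩)) a 0 + (if (k : ℕ) = 0 then B a 0 else 0) =
      (Y * jordanMatrix z m) a (finSigmaFinEquiv ⟨i, k⟩) := by
    rw [← hY, Matrix.add_apply]
    simp [Matrix.mul_apply, jordanRow_apply]
  induction j with
  | zero =>
    have h : (z i • (1 : Matrix ι ι ℂ) - A) *
        Y.submatrix id (fun _ : Fin 1 => finSigmaFinEquiv ⟨i, ⟨0, hj⟩⟩) = B := by
      ext a b
      have := hAY a ⟨0, hj⟩
      rw [mul_jordanMatrix_apply_zero z m Y a i _ rfl, if_pos rfl] at this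
      rw [Subsingleton.elim b 0, Matrix.sub_mul, Matrix.smul_mul, Matrix.one_mul,
        Matrix.sub_apply, Matrix.smul_apply, Matrix.submatrix_apply, smul_eq_mul, id, ← this]
      ring
    rw [pow_zero, one_smul, zero_add, pow_one]
    rw [← Matrix.nonsing_inv_mul_cancel_left _
      (Y.submatrix id (fun _ : Fin 1 => finSigmaFinEquiv ⟨i, ⟨0, hj⟩⟩)) hdet, h]
  | succ j ih =>
    have hj' : j < m i := by omega
    have h : (z i • (1 : Matrix ι ι ℂ) - A) *
        Y.submatrix id (fun _ : Fin 1 => finSigmaFinEquiv ⟨i, ⟨j + 1, hj⟩⟩) =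
        -Y.submatrix id (fun _ : Fin 1 => finSigmaFinEquiv ⟨i, ⟨j, hj'⟩⟩) := by
      ext a b
      have := hAY a ⟨j + 1, hj⟩
      rw [mul_jordanMatrix_apply_succ z m Y a i ⟨j, hj'⟩ _ rfl, if_neg (by simp)] at this
      rw [Subsingleton.elim b 0, Matrix.sub_mul, Matrix.smul_mul, Matrix.one_mul,
        Matrix.sub_apply, Matrix.smul_apply, Matrix.submatrix_apply, smul_eq_mul, id,
        Matrix.neg_apply, Matrix.submatrix_apply, id]
      linear_combination -this
    rw [← Matrix.nonsing_inv_mul_cancel_left _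
      (Y.submatrix id (fun _ : Fin 1 => finSigmaFinEquiv ⟨i, ⟨j + 1, hj⟩⟩)) hdet, h, ih hj',
      pow_succ' _ (j + 1), Matrix.mul_assoc, Matrix.mul_neg, Matrix.mul_smul, pow_succ (-1 : ℂ),
      mul_neg_one, neg_smul]

/-- Up to the sign `(-1)^j`, the moments at the interpolation points are the entries of `C Y`, where
`Y` solves the Sylvester equation in Jordan coordinates. -/
theorem iteratedDeriv_eq_sylvester {r : ℕ} (z : Fin r → ℂ) (m : Fin r → ℕ) (A : Matrix ι ι ℂ)
    (B : Matrix ι (Fin 1) ℂ) (C : Matrix (Fin 1) ι ℂ) (Y : Matrix ι (Fin (∑ i, m i)) ℂ)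
    (hY : A * Y + B * jordanRow m = Y * jordanMatrix z m) (i : Fin r)
    (hi : IsUnit (z i • (1 : Matrix ι ι ℂ) - A)) (j : ℕ) (hj : j < m i) :
    (-1) ^ j / (j.factorial : ℂ) *
      iteratedDeriv j (fun w : ℂ => (C * (w • (1 : Matrix ι ι ℂ) - A)⁻¹ * B) 0 0) (z i) =
      (-1) ^ j * (C * Y) 0 (finSigmaFinEquiv ⟨i, ⟨j, hj⟩⟩) := by
  have h1 : (C * Y) 0 (finSigmaFinEquiv ⟨i, ⟨j, hj⟩⟩) =
      (C * Y.submatrix id (fun _ : Fin 1 => finSigmaFinEquiv ⟨i, ⟨j, hj⟩⟩)) 0 0 := by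
    simp [Matrix.mul_apply]
  have h2 : (j.factorial : ℂ) ≠ 0 := by exact_mod_cast j.factorial_ne_zero
  rw [h1, jordan_sylvester_column z m A B Y hY i hi j hj, iteratedDeriv_resolvent A B C j _ hi,
    Matrix.mul_smul, Matrix.smul_apply, smul_eq_mul, ← Matrix.mul_assoc]
  field_simp

theorem jordan_sylvester_unique {r : ℕ} (z : Fin r → ℂ) (m : Fin r → ℕ) (A : Matrix ι ι ℂ)
    (hA : ∀ i, IsUnit (z i • (1 : Matrix ι ι ℂ) - A)) (Y : Matrix ι (Fin (∑ i, m i)) ℂ)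
    (hY : A * Y = Y * jordanMatrix z m) : Y = 0 := by
  ext a k
  obtain ⟨⟨i, l⟩, rfl⟩ := finSigmaFinEquiv.surjective k
  have h := jordan_sylvester_column z m A 0 Y (by rw [Matrix.zero_mul, add_zero, hY]) i (hA i) l l.2
  rw [Matrix.mul_zero, smul_zero] at h
  exact congrFun (congrFun h a) 0

end JordanSylvester

/-! ### The input-output realisation -/

section Realisation
variable {n : ℕ} (a b : Fin n → ℝ)

theorem ioStateMatrix_mulVec_inl_last (v : Fin n ⊕ Fin n → ℂ) (i : Fin n) (hi : (i : ℕ) + 1 = n) :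
    ((ioStateMatrix a b).map Complex.ofReal).mulVec v (.inl i) =
      -∑ j, (a j : ℂ) * v (.inl j) + ∑ j, (b j : ℂ) * v (.inr j) := by
  simp [Matrix.mulVec, dotProduct, Fintype.sum_sum_type, ioStateMatrix, hi]

theorem ioStateMatrix_mulVec_inl_succ (v : Fin n ⊕ Fin n → ℂ) (i j : Fin n)
    (hij : (i : ℕ) + 1 = j) :
    ((ioStateMatrix a b).map Complex.ofReal).mulVec v (.inl i) = v (.inl j) := by
  simp [Matrix.mulVec, dotProduct, Fintype.sum_sum_type, ioStateMatrix, hij, Fin.val_inj,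
    j.2.ne, apply_ite Complex.ofReal, ite_mul]

theorem ioStateMatrix_mulVec_inr_last (v : Fin n ⊕ Fin n → ℂ) (i : Fin n) (hi : (i : ℕ) + 1 = n) :
    ((ioStateMatrix a b).map Complex.ofReal).mulVec v (.inr i) = 0 := by
  have h (j : Fin n) : ¬ n = (j : ℕ) := j.2.ne'
  simp [Matrix.mulVec, dotProduct, Fintype.sum_sum_type, ioStateMatrix, hi, h]

theorem ioStateMatrix_mulVec_inr_succ (v : Fin n ⊕ Fin n → ℂ) (i j : Fin n)
    (hij : (i : ℕ) + 1 = j) :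
    ((ioStateMatrix a b).map Complex.ofReal).mulVec v (.inr i) = v (.inr j) := by
  simp [Matrix.mulVec, dotProduct, Fintype.sum_sum_type, ioStateMatrix, hij, Fin.val_inj,
    apply_ite Complex.ofReal, ite_mul]

/-- The eigenvalues of the input-output realisation are `0` and roots of the denominator: in an
eigenvector the input block is annihilated by a nilpotent shift, and the output block is a multiple
of `(1, z, …, z^(n-1))`. -/
theorem isUnit_smul_one_sub_ioStateMatrix (z : ℂ) (hz : z ≠ 0)
    (hden : z ^ n + ∑ i : Fin n, (a i : ℂ) * z ^ (i : ℕ) ≠ 0) :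
    IsUnit (z • (1 : Matrix (Fin n ⊕ Fin n) (Fin n ⊕ Fin n) ℂ) -
      (ioStateMatrix a b).map Complex.ofReal) := by
  rw [← Matrix.mulVec_injective_iff_isUnit]
  refine (injective_iff_map_eq_zero (Matrix.mulVecLin (z • 1 -
    (ioStateMatrix a b).map Complex.ofReal))).2 fun v hv => ?_
  have h (s : Fin n ⊕ Fin n) :
      ((ioStateMatrix a b).map Complex.ofReal).mulVec v s = z * v s := by
    have := congrFun hv s
    rw [Matrix.mulVecLin_apply, Matrix.sub_mulVec, Matrix.smul_mulVec, Matrix.one_mulVec,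
      Pi.sub_apply, Pi.smul_apply, Pi.zero_apply, sub_eq_zero, smul_eq_mul] at this
    exact this.symm
  have hr (k : ℕ) : ∀ i : Fin n, (i : ℕ) + k + 1 = n → v (.inr i) = 0 := by
    induction k with
    | zero =>
      intro i hi
      have := h (.inr i)
      rw [ioStateMatrix_mulVec_inr_last a b v i hi] at this
      exact (mul_eq_zero.1 this.symm).resolve_left hz
    | succ k ih =>
      intro i hi
      have := h (.inr i)
      rw [ioStateMatrix_mulVec_inr_succ a b v i ⟨i + 1, by omega⟩ rfl,
        ih ⟨i + 1, by omega⟩ (by simp; omega)] at this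
      exact (mul_eq_zero.1 this.symm).resolve_left hz
  have hr' (i : Fin n) : v (.inr i) = 0 := hr (n - 1 - i) i (by have := i.2; omega)
  rcases Nat.eq_zero_or_pos n with rfl | hn
  · exact Subsingleton.elim _ _
  have hl (k : ℕ) : ∀ hk : k < n, v (.inl ⟨k, hk⟩) = z ^ k * v (.inl ⟨0, hn⟩) := by
    induction k with
    | zero => simp
    | succ k ih =>
      intro hk
      rw [← ioStateMatrix_mulVec_inl_succ a b v ⟨k, by omega⟩ ⟨k + 1, hk⟩ rfl, h, ih]
      ring
  have h0 : v (.inl ⟨0, hn⟩) = 0 := by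
    have := h (.inl ⟨n - 1, by omega⟩)
    rw [ioStateMatrix_mulVec_inl_last a b v _ (by simp; omega), hl] at this
    have h1 : ∑ j, (a j : ℂ) * v (.inl j) =
        (∑ j : Fin n, (a j : ℂ) * z ^ (j : ℕ)) * v (.inl ⟨0, hn⟩) := by
      rw [Finset.sum_mul]
      exact Finset.sum_congr rfl fun j _ => by rw [hl j j.2]; ring
    have h2 : z ^ n = z * z ^ (n - 1) := by rw [← pow_succ', Nat.sub_add_cancel hn]
    rw [h1] at this
    simp only [hr', mul_zero, Finset.sum_const_zero, add_zero] at this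
    refine (mul_eq_zero.1 ?_).resolve_left hden
    rw [h2]
    linear_combination -this
  funext s
  rcases s with i | i
  · rw [hl i i.2, h0, mul_zero]; rfl
  · exact hr' i

/-- With output row `e_n Ã`, which reads off `y(k)`, the input-output realisation has the transfer
function `W = (∑ bᵢ zⁱ) / (zⁿ + ∑ aᵢ zⁱ)`: the vector `v = (W z⁻ⁿ, …, W z⁻¹, z⁻ⁿ, …, z⁻¹)` solves
`(zI - Ã) v = B̃`. -/
theorem ioRealisation_transfer (hn : 0 < n) (z : ℂ) (hz : z ≠ 0)
    (hden : z ^ n + ∑ i : Fin n, (a i : ℂ) * z ^ (i : ℕ) ≠ 0) :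
    ((selectorRow n * ioStateMatrix a b).map Complex.ofReal *
      (z • (1 : Matrix (Fin n ⊕ Fin n) (Fin n ⊕ Fin n) ℂ) -
        (ioStateMatrix a b).map Complex.ofReal)⁻¹ * (ioInputMatrix n).map Complex.ofReal) 0 0 =
      (∑ i : Fin n, (b i : ℂ) * z ^ (i : ℕ)) /
        (z ^ n + ∑ i : Fin n, (a i : ℂ) * z ^ (i : ℕ)) := by
  set W := (∑ i : Fin n, (b i : ℂ) * z ^ (i : ℕ)) /
        (z ^ n + ∑ i : Fin n, (a i : ℂ) * z ^ (i : ℕ)) with hW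
  let last : Fin n := ⟨n - 1, by omega⟩
  have hlast : (last : ℕ) + 1 = n := Nat.sub_add_cancel hn
  let v : Fin n ⊕ Fin n → ℂ :=
    Sum.elim (fun i => W * (z ^ (i : ℕ) / z ^ n)) (fun i => z ^ (i : ℕ) / z ^ n)
  have hzn : z ^ n ≠ 0 := pow_ne_zero _ hz
  have hzl : z * z ^ (last : ℕ) = z ^ n := by rw [← pow_succ', hlast]
  have hWeq : W * (z ^ n + ∑ i : Fin n, (a i : ℂ) * z ^ (i : ℕ)) =
      ∑ i : Fin n, (b i : ℂ) * z ^ (i : ℕ) := div_mul_cancel₀ _ hden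
  have hAl : ((ioStateMatrix a b).map Complex.ofReal).mulVec v (.inl last) = W := by
    rw [ioStateMatrix_mulVec_inl_last a b v last hlast]
    have h1 : ∑ j, (a j : ℂ) * v (.inl j) = W * (∑ j : Fin n, (a j : ℂ) * z ^ (j : ℕ)) / z ^ n := by
      rw [Finset.mul_sum, Finset.sum_div]
      exact Finset.sum_congr rfl fun j _ => by simp only [v, Sum.elim_inl]; ring
    have h2 : ∑ j, (b j : ℂ) * v (.inr j) = (∑ j : Fin n, (b j : ℂ) * z ^ (j : ℕ)) / z ^ n := by
      rw [Finset.sum_div]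
      exact Finset.sum_congr rfl fun j _ => by simp only [v, Sum.elim_inr]; ring
    rw [h1, h2, ← hWeq]
    field_simp
    ring
  have hv : (z • (1 : Matrix (Fin n ⊕ Fin n) (Fin n ⊕ Fin n) ℂ) -
      (ioStateMatrix a b).map Complex.ofReal).mulVec v =
      fun s => (ioInputMatrix n).map Complex.ofReal s 0 := by
    funext s
    rw [Matrix.sub_mulVec, Matrix.smul_mulVec, Matrix.one_mulVec, Pi.sub_apply, Pi.smul_apply,
      smul_eq_mul]
    rcases s with i | i
    · have hB : (ioInputMatrix n).map Complex.ofReal (.inl i) 0 = 0 := by simp [ioInputMatrix]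
      rw [hB, sub_eq_zero]
      by_cases hi : (i : ℕ) + 1 = n
      · obtain rfl : i = last := Fin.ext (by omega)
        rw [hAl]
        simp only [v, Sum.elim_inl]
        rw [mul_left_comm, mul_div_assoc', hzl, div_self hzn, mul_one]
      · rw [ioStateMatrix_mulVec_inl_succ a b v i ⟨i + 1, by omega⟩ rfl]
        simp only [v, Sum.elim_inl]
        ring
    · by_cases hi : (i : ℕ) + 1 = n
      · obtain rfl : i = last := Fin.ext (by omega)
        rw [ioStateMatrix_mulVec_inr_last a b v _ hi]
        simp only [v, Sum.elim_inr, ioInputMatrix, Matrix.map_apply, Matrix.of_apply, hi, if_true]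
        rw [mul_div_assoc', hzl, div_self hzn]
        simp
      · rw [ioStateMatrix_mulVec_inr_succ a b v i ⟨i + 1, by omega⟩ rfl]
        simp only [v, Sum.elim_inr, ioInputMatrix, Matrix.map_apply, Matrix.of_apply, hi, if_false]
        simp
        ring
  have hu := (Matrix.isUnit_iff_isUnit_det _).1 (isUnit_smul_one_sub_ioStateMatrix a b z hz hden)
  have hR : (z • (1 : Matrix (Fin n ⊕ Fin n) (Fin n ⊕ Fin n) ℂ) -
      (ioStateMatrix a b).map Complex.ofReal)⁻¹ * (ioInputMatrix n).map Complex.ofReal =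
      Matrix.of fun s _ => v s := by
    have : (ioInputMatrix n).map Complex.ofReal = (z • 1 -
        (ioStateMatrix a b).map Complex.ofReal) * Matrix.of fun s (_ : Fin 1) => v s := by
      ext s t
      rw [Subsingleton.elim t 0]
      exact (congrFun hv s).symm
    rw [this, Matrix.nonsing_inv_mul_cancel_left _ _ hu]
  have hmap : (selectorRow n * ioStateMatrix a b).map Complex.ofReal =
      (selectorRow n).map Complex.ofReal * (ioStateMatrix a b).map Complex.ofReal :=
    Matrix.map_mul (f := Complex.ofRealHom)
  rw [Matrix.mul_assoc, hR, hmap, Matrix.mul_assoc, ← hAl, Matrix.mul_apply, Fintype.sum_sum_type,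
    Finset.sum_eq_single last]
  · simp [selectorRow, hlast]
    rfl
  · intro i _ hi
    have : (i : ℕ) + 1 ≠ n := fun h => hi (Fin.ext (by omega))
    simp [selectorRow, this]
  · simp

end Realisation

theorem charpoly_denominator_ne_zero {n : ℕ} (A : Matrix (Fin n) (Fin n) ℝ) (z : ℂ)
    (hz : z ∉ eigenvalueSet A) : z ^ n + ∑ i : Fin n, (denCoeff A i : ℂ) * z ^ (i : ℕ) ≠ 0 := by
  rw [eigenvalueSet, ← isUnit_smul_one_sub_iff, Matrix.isUnit_iff_isUnit_det,
    isUnit_iff_ne_zero] at hz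
  have h1 : (z • (1 : Matrix (Fin n) (Fin n) ℂ) - A.map Complex.ofReal).det =
      A.charpoly.eval₂ Complex.ofRealHom z := by
    have h := Matrix.eval_charpoly (A.map Complex.ofReal) z
    rw [Matrix.scalar_apply, ← Matrix.smul_one_eq_diagonal] at h
    rw [← h, ← Polynomial.eval_map]
    exact congrArg _ (Matrix.charpoly_map A Complex.ofRealHom)
  have h2 : A.charpoly.natDegree = n := by
    rw [Matrix.charpoly_natDegree_eq_dim, Fintype.card_fin]
  have h3 := Matrix.charpoly_monic A
  rw [Polynomial.Monic, Polynomial.leadingCoeff, h2] at h3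
  rw [h1, Polynomial.eval₂_eq_sum_range, h2, Finset.sum_range_succ, Finset.sum_range, h3] at hz
  simpa [denCoeff, add_comm] using hz

/-- The full-order system and its input-output realisation have the same transfer function near
every interpolation point, hence the same moments there. -/
theorem transferFunction_eventuallyEq {n : ℕ} (hn : 0 < n) (A : Matrix (Fin n) (Fin n) ℝ)
    (B : Matrix (Fin n) (Fin 1) ℝ) (C : Matrix (Fin 1) (Fin n) ℝ) (z : ℂ) (hz : z ≠ 0)
    (hzA : z ∉ eigenvalueSet A) :
    transferFunction A B C =ᶠ[nhds z] fun w =>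
      ((selectorRow n * ioStateMatrix (denCoeff A) (numCoeff A B C)).map Complex.ofReal *
      (w • (1 : Matrix (Fin n ⊕ Fin n) (Fin n ⊕ Fin n) ℂ) -
        (ioStateMatrix (denCoeff A) (numCoeff A B C)).map Complex.ofReal)⁻¹ *
        (ioInputMatrix n).map Complex.ofReal) 0 0 := by
  have h1 := eventually_isUnit_smul_one_sub _ ((isUnit_smul_one_sub_iff _ z).2 hzA)
  filter_upwards [h1, eventually_ne_nhds hz] with w hw hw0
  rw [transferFunction_eq_div, ioRealisation_transfer _ _ hn w hw0
    (charpoly_denominator_ne_zero A w ((isUnit_smul_one_sub_iff _ w).1 hw))]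

/-- The noisy data satisfy `X̄₊ = Ã X̄₋ + B̃ Ū₋ - R₋`. This holds for all signals, because the
process noise of the aggregated state is defined as the residual of `x̃(k+1) = Ã x̃(k) + B̃ u(k)`. -/
theorem noisy_data_equation {n T : ℕ} (a b : Fin n → ℝ) (y u Δy Δu : ℤ → ℝ) :
    dataPlus T (aggregate n y u) + dataPlus T (aggregate n Δy Δu) =
      ioStateMatrix a b *
          (dataMinus T (aggregate n y u) + dataMinus T (aggregate n Δy Δu)) +
        ioInputMatrix n * (dataMinus T (fun k (_ : Fin 1) => u k) +
          dataMinus T (fun k (_ : Fin 1) => Δu k)) -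
        noiseMatrix T a b y u Δy Δu := by
  have h : dataPlus T (aggregate n y u) = ioStateMatrix a b * dataMinus T (aggregate n y u) +
      ioInputMatrix n * dataMinus T (fun k (_ : Fin 1) => u k) +
      dataMinus T (aggregateProcessNoise a b y u) := by
    ext s t
    simp only [dataPlus, dataMinus, aggregateProcessNoise, Matrix.add_apply, Matrix.of_apply,
      Pi.sub_apply, Pi.add_apply, Matrix.mul_apply, Matrix.mulVec, dotProduct]
    ring
  rw [h, noiseMatrix, Matrix.mul_add, Matrix.mul_add]
  abel

/-! ### Moments and the Sylvester equation with `(S, L)` -/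

section
variable {ι : Type*} [Fintype ι] {r : ℕ} {z : Fin r → ℂ} {m : Fin r → ℕ}
  {S : Matrix (Fin (∑ i, m i)) (Fin (∑ i, m i)) ℝ} {L : Matrix (Fin 1) (Fin (∑ i, m i)) ℝ}
  {P : Matrix (Fin (∑ i, m i)) (Fin (∑ i, m i)) ℂ}

/-- A solution `X` of the real Sylvester equation with `(S, L)` becomes the solution `X P⁻¹` of the
Sylvester equation with the Jordan pair. -/
theorem IsJordanTransformation.sylvester (hP : IsJordanTransformation z m S L P)
    {A : Matrix ι ι ℝ} {B : Matrix ι (Fin 1) ℝ} {X : Matrix ι (Fin (∑ i, m i)) ℝ}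
    (hX : A * X + B * L = X * S) :
    A.map Complex.ofReal * (X.map Complex.ofReal * P⁻¹) + B.map Complex.ofReal * jordanRow m =
      X.map Complex.ofReal * P⁻¹ * jordanMatrix z m := by
  obtain ⟨hPu, hS, hL⟩ := hP
  have hdet := (Matrix.isUnit_iff_isUnit_det _).1 hPu
  have h : A.map Complex.ofReal * X.map Complex.ofReal + B.map Complex.ofReal *
      L.map Complex.ofReal = X.map Complex.ofReal * S.map Complex.ofReal := by
    have := congrArg (fun M : Matrix ι (Fin (∑ i, m i)) ℝ => M.map Complex.ofRealHom) hX
    simp only [Matrix.map_add _ (map_add Complex.ofRealHom), Matrix.map_mul] at this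
    exact this
  have h2 := congrArg (· * P⁻¹) h
  simp only [hL, hS, Matrix.add_mul, Matrix.mul_assoc, Matrix.mul_nonsing_inv _ hdet,
    Matrix.mul_one] at h2
  simpa only [Matrix.mul_assoc] using h2

/-- The homogeneous Sylvester equation has only the zero solution if no interpolation point is an
eigenvalue of `A`. -/
theorem IsJordanTransformation.sylvester_unique [DecidableEq ι]
    (hP : IsJordanTransformation z m S L P)
    {A : Matrix ι ι ℝ} (hA : ∀ i, IsUnit (z i • (1 : Matrix ι ι ℂ) - A.map Complex.ofReal))
    (X : Matrix ι (Fin (∑ i, m i)) ℝ) (hX : A * X = X * S) : X = 0 := by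
  have h := hP.sylvester (B := 0) (X := X) (A := A) (by rw [Matrix.zero_mul, add_zero, hX])
  rw [Matrix.map_zero _ Complex.ofReal_zero, Matrix.zero_mul, add_zero] at h
  have h0 := jordan_sylvester_unique z m _ hA _ h
  have h1 : X.map Complex.ofReal = 0 := by
    rw [← Matrix.nonsing_inv_mul_cancel_right P (X.map Complex.ofReal)
      ((Matrix.isUnit_iff_isUnit_det _).1 hP.1), h0, Matrix.zero_mul]
  ext i j
  exact Complex.ofReal_injective (congrFun (congrFun h1 i) j)

/-- The moments of `(A, B, C)` at the interpolation points are, up to sign, the entries of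
`C X P⁻¹`, where `X` solves the Sylvester equation with `(S, L)`. -/
theorem IsJordanTransformation.iteratedDeriv_eq [DecidableEq ι]
    (hP : IsJordanTransformation z m S L P)
    {A : Matrix ι ι ℝ} {B : Matrix ι (Fin 1) ℝ} {X : Matrix ι (Fin (∑ i, m i)) ℝ}
    (hX : A * X + B * L = X * S) (C : Matrix (Fin 1) ι ℝ) (i : Fin r)
    (hi : IsUnit (z i • (1 : Matrix ι ι ℂ) - A.map Complex.ofReal)) (j : ℕ) (hj : j < m i) :
    (-1) ^ j / (j.factorial : ℂ) * iteratedDeriv j (fun w : ℂ => (C.map Complex.ofReal *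
      (w • (1 : Matrix ι ι ℂ) - A.map Complex.ofReal)⁻¹ * B.map Complex.ofReal) 0 0) (z i) =
      (-1) ^ j * ((C * X).map Complex.ofReal * P⁻¹) 0 (finSigmaFinEquiv ⟨i, ⟨j, hj⟩⟩) := by
  have hmap : (C * X).map Complex.ofReal = C.map Complex.ofReal * X.map Complex.ofReal :=
    Matrix.map_mul (f := Complex.ofRealHom)
  rw [iteratedDeriv_eq_sylvester z m _ _ _ _ (hP.sylvester hX) i hi j hj, hmap, Matrix.mul_assoc]
end

theorem mem_eigenvalueSet_of_charpoly {r : ℕ} {z : Fin r → ℂ} {m : Fin r → ℕ}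
    {S : Matrix (Fin (∑ i, m i)) (Fin (∑ i, m i)) ℝ}
    (hSchar : S.charpoly.map (algebraMap ℝ ℂ) = ∏ i, (Polynomial.X - Polynomial.C (z i)) ^ m i)
    (i : Fin r) (hi : 0 < m i) : z i ∈ eigenvalueSet S := by
  have h : (S.map Complex.ofReal).charpoly = S.charpoly.map (algebraMap ℝ ℂ) :=
    Matrix.charpoly_map S Complex.ofRealHom
  rw [eigenvalueSet, Matrix.mem_spectrum_iff_isRoot_charpoly, h, hSchar, Polynomial.IsRoot,
    Polynomial.eval_prod]
  exact Finset.prod_eq_zero (Finset.mem_univ i) (by simp [hi.ne'])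

theorem selectorRow_mul_ioInputMatrix (n : ℕ) : selectorRow n * ioInputMatrix n = 0 := by
  ext s t
  simp [Matrix.mul_apply, Fintype.sum_sum_type, selectorRow, ioInputMatrix]

theorem frobeniusNorm_selectorRow_mul_le {n : ℕ} (hn : 0 < n) {κ : Type*} [Fintype κ]
    (E : Matrix (Fin n ⊕ Fin n) κ ℝ) : frobeniusNorm (selectorRow n * E) ≤ frobeniusNorm E := by
  let last : Fin n := ⟨n - 1, by omega⟩
  have hlast : (last : ℕ) + 1 = n := Nat.sub_add_cancel hn
  have h (k : κ) : (selectorRow n * E) 0 k = E (.inl last) k := by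
    rw [Matrix.mul_apply, Fintype.sum_sum_type, Finset.sum_eq_single last]
    · simp [selectorRow, hlast]
    · intro i _ hi
      have : (i : ℕ) + 1 ≠ n := fun h => hi (Fin.ext (by omega))
      simp [selectorRow, this]
    · simp
  refine Real.sqrt_le_sqrt ?_
  rw [Fin.sum_univ_one]
  simp only [h]
  exact Finset.single_le_sum (f := fun i => ∑ k, ‖E i k‖ ^ 2) (fun i _ => by positivity)
    (Finset.mem_univ _)

end MomentMatching

open MomentMatching
theorem mainTheorem2 {n r T : ℕ} (hn : 0 < n)
    -- the full-order system, assumed minimal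
    (A : Matrix (Fin n) (Fin n) ℝ) (B : Matrix (Fin n) (Fin 1) ℝ) (C : Matrix (Fin 1) (Fin n) ℝ)
    (hAB : IsControllable A B) (hAC : IsObservable A C)
    -- the interpolation points and their multiplicities
    (z : Fin r → ℂ) (hz : Function.Injective z) (m : Fin r → ℕ) (hm : ∀ i, 0 < m i)
    (hzA : ∀ i, z i ∉ eigenvalueSet A) (hz0 : ∀ i, z i ≠ 0)
    -- the pair `(S, L)` and the free parameter `G`
    (S : Matrix (Fin (∑ i, m i)) (Fin (∑ i, m i)) ℝ) (L : Matrix (Fin 1) (Fin (∑ i, m i)) ℝ)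
    (hSnd : minpoly ℝ S = S.charpoly)
    (hSchar : S.charpoly.map (algebraMap ℝ ℂ) =
      ∏ i, (Polynomial.X - Polynomial.C (z i)) ^ m i)
    (hSL : IsObservable S L)
    (G : Matrix (Fin (∑ i, m i)) (Fin 1) ℝ)
    (hG : Disjoint (eigenvalueSet S) (eigenvalueSet (S - G * L)))
    -- input, state, output and process noise of the full-order system
    (u y : ℤ → ℝ) (x d : ℤ → Fin n → ℝ)
    (hx : ∀ k : ℤ, -(n : ℤ) ≤ k →
      x (k + 1) = A.mulVec (x k) + B.mulVec (fun _ => u k) + d k)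
    (hy : ∀ k : ℤ, -(n : ℤ) ≤ k → y k = C.mulVec (x k) 0)
    -- measurement noise, and the resulting noisy data matrices
    (Δu Δy : ℤ → ℝ)
    (Xbarm Xbarp : Matrix (Fin n ⊕ Fin n) (Fin T) ℝ) (Ubarm : Matrix (Fin 1) (Fin T) ℝ)
    (hXm : Xbarm = dataMinus T (aggregate n y u) + dataMinus T (aggregate n Δy Δu))
    (hXp : Xbarp = dataPlus T (aggregate n y u) + dataPlus T (aggregate n Δy Δu))
    (hUm : Ubarm = dataMinus T (fun k (_ : Fin 1) => u k) +
      dataMinus T (fun k (_ : Fin 1) => Δu k))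
    -- a solution of the noisy linear programme
    (Ghat : Matrix (Fin T) (Fin (∑ i, m i)) ℝ)
    (hGhat₁ : Xbarp * Ghat = Xbarm * Ghat * S) (hGhat₂ : Ubarm * Ghat = L) :
    (∃! P : Matrix (Fin (∑ i, m i)) (Fin (∑ i, m i)) ℂ, IsJordanTransformation z m S L P) ∧
    ∀ P : Matrix (Fin (∑ i, m i)) (Fin (∑ i, m i)) ℂ, IsJordanTransformation z m S L P →
      ∀ i : Fin r, ∀ j : ℕ, j < m i →
        ‖moment A B C j (z i) -
            moment (S - G * L) G (selectorRow n * Xbarm * Ghat * S) j (z i)‖ ≤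
          matrixTwoNorm S * matrixTwoNorm P⁻¹ * frobeniusNorm Ghat /
            sigmaMin ((1 : Matrix (Fin (∑ i, m i)) (Fin (∑ i, m i)) ℝ) ⊗ₖ
                ioStateMatrix (denCoeff A) (numCoeff A B C) -
              S.transpose ⊗ₖ (1 : Matrix (Fin n ⊕ Fin n) (Fin n ⊕ Fin n) ℝ)) *
            matrixTwoNorm (noiseMatrix T (denCoeff A) (numCoeff A B C) y u Δy Δu) := by
  refine ⟨existsUnique_isJordanTransformation z hz m S L hSchar hSL, fun P hP i j hj => ?_⟩
  set a := denCoeff A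
  set b := numCoeff A B C
  set R := noiseMatrix T a b y u Δy Δu with hR
  have hunit (i : Fin r) := isUnit_smul_one_sub_ioStateMatrix a b (z i) (hz0 i)
    (charpoly_denominator_ne_zero A (z i) (hzA i))
  have hinj := hP.sylvester_unique hunit
  -- the solution that noise-free data would give
  obtain ⟨X, hX⟩ := exists_sylvester_solution (ioStateMatrix a b) S hinj (ioInputMatrix n * L)
  -- the matrix obtained from the noisy data solves the same equation up to `R Ĝ`
  have hpert : ioStateMatrix a b * (Xbarm * Ghat) - Xbarm * Ghat * S =
      R * Ghat - ioInputMatrix n * L := by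
    rw [← hGhat₁, ← hGhat₂, hXp, noisy_data_equation a b, ← hXm, ← hUm, Matrix.sub_mul,
      Matrix.add_mul]
    simp only [Matrix.mul_assoc]
    abel
  have hE : ioStateMatrix a b * (X - Xbarm * Ghat) - (X - Xbarm * Ghat) * S = -(R * Ghat) := by
    rw [Matrix.mul_sub, Matrix.sub_mul, ← hX, sub_sub_sub_comm, hpert]
    abel
  have hfull : moment A B C j (z i) = (-1) ^ j *
      ((selectorRow n * X * S).map Complex.ofReal * P⁻¹) 0 (finSigmaFinEquiv ⟨i, ⟨j, hj⟩⟩) := by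
    rw [moment, (transferFunction_eventuallyEq hn A B C (z i) (hz0 i) (hzA i)).iteratedDeriv_eq j,
      hP.iteratedDeriv_eq hX _ i (hunit i) j hj, Matrix.mul_assoc (selectorRow n) X, ← hX,
      Matrix.mul_add, ← Matrix.mul_assoc _ (ioInputMatrix n), selectorRow_mul_ioInputMatrix,
      Matrix.zero_mul, add_zero, Matrix.mul_assoc]
  have hred : moment (S - G * L) G (selectorRow n * Xbarm * Ghat * S) j (z i) = (-1) ^ j *
      ((selectorRow n * (Xbarm * Ghat) * S).map Complex.ofReal * P⁻¹) 0
        (finSigmaFinEquiv ⟨i, ⟨j, hj⟩⟩) := by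
    -- the reduced model solves its own Sylvester equation with `X = 1`
    have hi : z i ∉ eigenvalueSet (S - G * L) :=
      Set.disjoint_left.1 hG (mem_eigenvalueSet_of_charpoly hSchar i (hm i))
    have h := hP.iteratedDeriv_eq (A := S - G * L) (B := G) (X := 1) (by simp)
      (selectorRow n * (Xbarm * Ghat) * S) i ((isUnit_smul_one_sub_iff _ _).2 hi) j hj
    rw [Matrix.mul_one] at h
    rw [moment, Matrix.mul_assoc (selectorRow n) Xbarm]
    exact h
  have hdiff : ‖moment A B C j (z i) -
      moment (S - G * L) G (selectorRow n * Xbarm * Ghat * S) j (z i)‖ =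
      ‖((selectorRow n * (X - Xbarm * Ghat) * S).map Complex.ofReal * P⁻¹) 0
        (finSigmaFinEquiv ⟨i, ⟨j, hj⟩⟩)‖ := by
    have hmap : (selectorRow n * (X - Xbarm * Ghat) * S).map Complex.ofReal =
        (selectorRow n * X * S).map Complex.ofReal -
          (selectorRow n * (Xbarm * Ghat) * S).map Complex.ofReal := by
      rw [Matrix.mul_sub, Matrix.sub_mul]
      exact Matrix.map_sub _ (map_sub Complex.ofRealHom) _ _
    rw [hfull, hred, ← mul_sub, norm_mul, norm_pow, norm_neg, norm_one, one_pow, one_mul, hmap,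
      Matrix.sub_mul, Matrix.sub_apply]
  have : Nonempty (Fin (∑ i, m i)) := ⟨finSigmaFinEquiv ⟨i, ⟨j, hj⟩⟩⟩
  have : Nonempty (Fin n) := ⟨⟨0, hn⟩⟩
  have hEbound := frobeniusNorm_le_of_sylvester (ioStateMatrix a b) S hinj (X - Xbarm * Ghat)
  rw [hE, frobeniusNorm_neg] at hEbound
  set σ := sigmaMin ((1 : Matrix (Fin (∑ i, m i)) (Fin (∑ i, m i)) ℝ) ⊗ₖ ioStateMatrix a b -
    S.transpose ⊗ₖ (1 : Matrix (Fin n ⊕ Fin n) (Fin n ⊕ Fin n) ℝ)) with hσ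
  have hσ0 : 0 ≤ σ := (sigmaMin_pos _ (sylvester_injective _ S hinj)).le
  have hS0 := matrixTwoNorm_nonneg S
  have hP0 := matrixTwoNorm_nonneg P⁻¹
  rw [hdiff]
  calc _ ≤ _ := norm_apply_le_frobeniusNorm _ _ _
    _ ≤ frobeniusNorm ((selectorRow n * (X - Xbarm * Ghat) * S).map Complex.ofReal) *
        matrixTwoNorm P⁻¹ := frobeniusNorm_mul_le_mul_matrixTwoNorm _ _
    _ = frobeniusNorm (selectorRow n * (X - Xbarm * Ghat) * S) * matrixTwoNorm P⁻¹ := by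
      rw [frobeniusNorm_map_ofReal]
    _ ≤ frobeniusNorm (selectorRow n * (X - Xbarm * Ghat)) * matrixTwoNorm S *
        matrixTwoNorm P⁻¹ := by gcongr; exact frobeniusNorm_mul_le_mul_matrixTwoNorm _ _
    _ ≤ frobeniusNorm (X - Xbarm * Ghat) * matrixTwoNorm S * matrixTwoNorm P⁻¹ := by
      gcongr; exact frobeniusNorm_selectorRow_mul_le hn _
    _ ≤ frobeniusNorm (R * Ghat) / σ * matrixTwoNorm S * matrixTwoNorm P⁻¹ := by gcongr
    _ ≤ matrixTwoNorm R * frobeniusNorm Ghat / σ * matrixTwoNorm S * matrixTwoNorm P⁻¹ := by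
      gcongr; exact frobeniusNorm_mul_le_matrixTwoNorm_mul _ _
    _ = _ := by ring
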